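/- Let $\mathbb{S}^2\subset\mathbb{R}^3$ be the unit sphere, let $\Omega$ be the group of orientation-preserving $C^\infty$ diffeomorphisms of $\mathbb{S}^2$, and regard $\operatorname{SO}(3)$ as a subset of $\Omega$, $A\in\operatorname{SO}(3)$ acting by $x\mapsto Ax$. Let $I=[0,1]$. Let $x_0=(0,0,-1)$ be the South Pole, let $\mathrm e_1=(1,0,0)$ and $\mathrm e_2=(0,1,0)$, which form a basis of $T_{x_0}\mathbb{S}^2$, put $$\Omega_1=\{f\in\Omega : f(x_0)=x_0,\ df|_{x_0}=\operatorname{id}_{T_{x_0}\mathbb{S}^2}\},$$ and define $i:\operatorname{SO}(3)\times\Omega_1\to\Omega$ by $i(A,f)=A^{-1}\circ f$. Smoothness is understood diffeologically. Let $U$ be any open subset of any Euclidean space $\mathbb{R}^n$. A map $P:U\to\Omega$ is a plot if $(s,x)\mapsto P(s)(x)$ is a $C^\infty$ map $U\times\mathbb{S}^2\to\mathbb{S}^2$; a map $U\to I$ is a plot if it is $C^\infty$; a map $U\to I\times\Omega$ is a plot if both of its components are plots. A map $Q:I\times\Omega\to\Omega$ is smooth if $Q\circ P$ is a plot of $\Omega$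 for every plot $P$ of $I\times\Omega$. **Theorem.** One has $$i(\operatorname{SO}(3)\times\Omega_1)=\{f\in\Omega : df|_{x_0}\mathrm e_1 \text{ and } df|_{x_0}\mathrm e_2 \text{ are orthonormal}\},$$ and there is a smooth map $Q:I\times\Omega\to\Omega$, $(t,f)\mapsto Q_t(f)$, such that for all $t\in I$, $f\in\Omega$ and $A\in\operatorname{SO}(3)$: 1. $Q_0(f)=f$; 2. $Q_1(f)\in i(\operatorname{SO}(3)\times\Omega_1)$; 3. $Q_t(A)=A$; 4. $Q_t(A\circ f)=A\circ Q_t(f)$. -/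

import Mathlib

open scoped Manifold ContDiff

namespace SphereDiff

noncomputable section

/-! ### Diffeologies given by plots on open subsets of Euclidean spaces -/

/-- A notion of plot on `Λ`: for every `n`, every set `U` of `ℝⁿ` (used only for open `U`) and every
map `P`, whether the restriction of `P` to `U` is a plot of `Λ`. -/
def Plots (Λ : Type*) : Type _ :=
  ∀ n : ℕ, Set (EuclideanSpace ℝ (Fin n)) → (EuclideanSpace ℝ (Fin n) → Λ) → Prop

/-- The plots of a manifold (with boundary or corners) are the smooth maps. -/
def manifoldPlots {E H : Type*} [NormedAddCommGroup E] [NormedSpace ℝ E] [TopologicalSpace H]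
    (J : ModelWithCorners ℝ E H) (M : Type*) [TopologicalSpace M] [ChartedSpace H M] : Plots M :=
  fun n U P => ContMDiffOn (𝓡 n) J ∞ P U

/-- The standard functional diffeology on a set `Λ` of maps `X → Y` between manifolds, where
`ev f x` is the value of `f : Λ` at `x`: a map `P : U → Λ` is a plot if
`(s, x) ↦ ev (P s) x` is smooth on `U × X`. -/
def functionalPlots {E H E' H' : Type*} [NormedAddCommGroup E] [NormedSpace ℝ E]
    [TopologicalSpace H] (J : ModelWithCorners ℝ E H)
    [NormedAddCommGroup E'] [NormedSpace ℝ E'] [TopologicalSpace H']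
    (K : ModelWithCorners ℝ E' H')
    {X Y : Type*} [TopologicalSpace X] [ChartedSpace H X] [TopologicalSpace Y] [ChartedSpace H' Y]
    {Λ : Type*} (ev : Λ → X → Y) : Plots Λ :=
  fun n U P => ContMDiffOn ((𝓡 n).prod J) K ∞
    (fun q : EuclideanSpace ℝ (Fin n) × X => ev (P q.1) q.2) (U ×ˢ Set.univ)

/-- The product diffeology. -/
def prodPlots {Λ Γ : Type*} (D : Plots Λ) (D' : Plots Γ) : Plots (Λ × Γ) :=
  fun n U P => D n U (fun s => (P s).1) ∧ D' n U (fun s => (P s).2)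

/-- A map is diffeologically smooth if it sends plots to plots. -/
def DiffeologicallySmooth {Λ Γ : Type*} (D : Plots Λ) (D' : Plots Γ) (φ : Λ → Γ) : Prop :=
  ∀ (n : ℕ) (U : Set (EuclideanSpace ℝ (Fin n))), IsOpen U →
    ∀ P : EuclideanSpace ℝ (Fin n) → Λ, D n U P → D' n U (fun s => φ (P s))

/-! ### The sphere and its orientation-preserving diffeomorphisms -/

/-- The unit sphere of `ℝ³`. -/
abbrev S2 : Type := Metric.sphere (0 : EuclideanSpace ℝ (Fin 3)) 1

/-- The differential at `x` of the inclusion of the sphere into `ℝ³`. It identifies the abstract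
tangent space at `x` with the plane of `ℝ³` orthogonal to `x`. -/
def tangentIncl (x : S2) : TangentSpace (𝓡 2) x →L[ℝ] EuclideanSpace ℝ (Fin 3) :=
  mvfderiv (𝓡 2) (fun y : S2 => (y : EuclideanSpace ℝ (Fin 3))) x

/-- The differential of `f : S² → S²` at `x`, its values being regarded as vectors of `ℝ³`. -/
def diffAt (f : S2 → S2) (x : S2) : TangentSpace (𝓡 2) x →L[ℝ] EuclideanSpace ℝ (Fin 3) :=
  (tangentIncl (f x)).comp (mfderiv (𝓡 2) (𝓡 2) f x)

/-- The determinant of three vectors of `ℝ³`. -/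
def det3 (u v w : EuclideanSpace ℝ (Fin 3)) : ℝ :=
  Matrix.det (Matrix.of ![WithLp.ofLp u, WithLp.ofLp v, WithLp.ofLp w])

/-- `S²` is oriented by the outward normal: `(v, w)` is a positive basis of the tangent space at `x`
when `det(x, v, w) > 0`. A map preserves the orientation if its differential sends
positive bases to positive bases. -/
def OrientationPreserving (f : S2 → S2) : Prop :=
  ∀ (x : S2) (v w : TangentSpace (𝓡 2) x), 0 < det3 x (tangentIncl x v) (tangentIncl x w) →
    0 < det3 (f x) (diffAt f x v) (diffAt f x w)

/-- `Ω`, the orientation-preserving smooth diffeomorphisms of `S²`. -/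
abbrev Omega : Type := {f : S2 ≃ₘ⟮𝓡 2, 𝓡 2⟯ S2 // OrientationPreserving f}

/-- The functional diffeology of `Ω`. -/
def omegaPlots : Plots Omega :=
  functionalPlots (𝓡 2) (𝓡 2) (fun (f : Omega) (x : S2) => f.1 x)

/-! ### Composition and rotations -/

theorem contMDiff_val : ContMDiff (𝓡 2) 𝓘(ℝ, EuclideanSpace ℝ (Fin 3)) ∞
    (fun y : S2 => (y : EuclideanSpace ℝ (Fin 3))) :=
  have := Fact.mk (@finrank_euclideanSpace_fin ℝ _ (2 + 1))
  contMDiff_coe_sphere (n := 2) (E := EuclideanSpace ℝ (Fin 3))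

theorem diffAt_eq {f : S2 → S2} (hf : ContMDiff (𝓡 2) (𝓡 2) ∞ f) (x : S2) :
    diffAt f x = mvfderiv (𝓡 2) (fun y : S2 => (f y : EuclideanSpace ℝ (Fin 3))) x := by
  ext1 v
  exact (mfderiv_comp_apply x ((contMDiff_val (f x)).mdifferentiableAt (by simp))
    ((hf x).mdifferentiableAt (by simp)) v).symm

theorem orientationPreserving_comp {f g : S2 → S2} (hf : ContMDiff (𝓡 2) (𝓡 2) ∞ f)
    (hg : ContMDiff (𝓡 2) (𝓡 2) ∞ g) (of : OrientationPreserving f)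
    (og : OrientationPreserving g) : OrientationPreserving (f ∘ g) := by
  have key (x : S2) (v : TangentSpace (𝓡 2) x) :
      diffAt (f ∘ g) x v = diffAt f (g x) (mfderiv (𝓡 2) (𝓡 2) g x v) :=
    congrArg (tangentIncl (f (g x))) (mfderiv_comp_apply x
      ((hf (g x)).mdifferentiableAt (by simp)) ((hg x).mdifferentiableAt (by simp)) v)
  intro x v w h
  rw [key, key]
  exact of (g x) _ _ (og x v w h)

/-- Composition `f ∘ g` in `Ω`. -/
def comp (f g : Omega) : Omega :=
  ⟨g.1.trans f.1, orientationPreserving_comp (f := f.1) (g := g.1) f.1.contMDiff g.1.contMDiff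
    f.2 g.2⟩

/-- The rotation group. -/
abbrev SO3 : Type := Matrix.specialOrthogonalGroup (Fin 3) ℝ

theorem rot_mem (A : SO3) (x : S2) :
    Matrix.toEuclideanCLM (𝕜 := ℝ) A.1 x ∈ Metric.sphere (0 : EuclideanSpace ℝ (Fin 3)) 1 := by
  have hA : A.1.transpose * A.1 = 1 :=
    (Matrix.mem_orthogonalGroup_iff' (Fin 3) ℝ).1
      (Matrix.mem_specialOrthogonalGroup_iff.1 A.2).1
  have hx : ‖(x : EuclideanSpace ℝ (Fin 3))‖ = 1 := by simp
  rw [mem_sphere_zero_iff_norm]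
  refine Eq.trans ?_ hx
  rw [← sq_eq_sq₀ (norm_nonneg _) (norm_nonneg _), ← real_inner_self_eq_norm_sq,
    ← real_inner_self_eq_norm_sq]
  simp only [EuclideanSpace.inner_eq_star_dotProduct, Matrix.ofLp_toEuclideanCLM, star_trivial]
  rw [Matrix.dotProduct_mulVec, ← Matrix.mulVec_transpose, Matrix.mulVec_mulVec, hA,
    Matrix.one_mulVec]

/-- The map `x ↦ A x` of the sphere. -/
def rotFun (A : SO3) (x : S2) : S2 := ⟨Matrix.toEuclideanCLM (𝕜 := ℝ) A.1 x, rot_mem A x⟩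

theorem contMDiff_rotFun (A : SO3) : ContMDiff (𝓡 2) (𝓡 2) ∞ (rotFun A) := by
  have := Fact.mk (@finrank_euclideanSpace_fin ℝ _ (2 + 1))
  exact ContMDiff.codRestrict_sphere (n := 2) (E := EuclideanSpace ℝ (Fin 3))
    ((Matrix.toEuclideanCLM (𝕜 := ℝ) A.1).contMDiff.comp contMDiff_val) (rot_mem A)

theorem rotFun_rotFun (A B : SO3) (x : S2) : rotFun A (rotFun B x) = rotFun (A * B) x := by
  apply Subtype.ext
  simp [rotFun, map_mul]

theorem rotFun_one (x : S2) : rotFun 1 x = x := by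
  apply Subtype.ext
  simp [rotFun]

theorem orientationPreserving_rotFun (A : SO3) : OrientationPreserving (rotFun A) := by
  have key (x : S2) (v : TangentSpace (𝓡 2) x) :
      diffAt (rotFun A) x v = Matrix.toEuclideanCLM (𝕜 := ℝ) A.1 (tangentIncl x v) := by
    rw [diffAt_eq (contMDiff_rotFun A)]
    have h := mfderiv_comp_apply (I := 𝓡 2) (I' := 𝓘(ℝ, EuclideanSpace ℝ (Fin 3)))
      (I'' := 𝓘(ℝ, EuclideanSpace ℝ (Fin 3))) x
      (g := fun y => Matrix.toEuclideanCLM (𝕜 := ℝ) A.1 y)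
      (f := fun y : S2 => (y : EuclideanSpace ℝ (Fin 3)))
      ((Matrix.toEuclideanCLM (𝕜 := ℝ) A.1).mdifferentiableAt)
      ((contMDiff_val x).mdifferentiableAt (by simp)) v
    refine h.trans ?_
    rw [ContinuousLinearMap.mfderiv_eq]
    rfl
  have hdet (u v w : EuclideanSpace ℝ (Fin 3)) :
      det3 (Matrix.toEuclideanCLM (𝕜 := ℝ) A.1 u) (Matrix.toEuclideanCLM (𝕜 := ℝ) A.1 v)
        (Matrix.toEuclideanCLM (𝕜 := ℝ) A.1 w) = det3 u v w := by
    have h1 : A.1.det = 1 := (Matrix.mem_specialOrthogonalGroup_iff.1 A.2).2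
    have : Matrix.of ![A.1.mulVec u.ofLp, A.1.mulVec v.ofLp, A.1.mulVec w.ofLp] =
        Matrix.of ![u.ofLp, v.ofLp, w.ofLp] * A.1.transpose := by
      ext i j
      fin_cases i <;> simp [Matrix.mul_apply, Matrix.mulVec, dotProduct, mul_comm]
    simp only [det3, Matrix.ofLp_toEuclideanCLM]
    rw [this, Matrix.det_mul, Matrix.det_transpose, h1, mul_one]
  intro x v w h
  rw [key, key]
  exact (hdet _ _ _).symm ▸ h

/-- `SO(3)` as a subset of `Ω`: the diffeomorphism `x ↦ A x`. -/
def rot (A : SO3) : Omega :=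
  ⟨{ toFun := rotFun A
     invFun := rotFun A⁻¹
     left_inv := fun x => by rw [rotFun_rotFun, inv_mul_cancel, rotFun_one]
     right_inv := fun x => by rw [rotFun_rotFun, mul_inv_cancel, rotFun_one]
     contMDiff_toFun := contMDiff_rotFun A
     contMDiff_invFun := contMDiff_rotFun A⁻¹ },
   orientationPreserving_rotFun A⟩

/-! ### Normalisation at the South Pole -/

/-- The South Pole `x₀ = (0, 0, -1)`. -/
def southPole : S2 := ⟨!₂[0, 0, -1], by
  rw [mem_sphere_zero_iff_norm, EuclideanSpace.norm_eq]; simp [Fin.sum_univ_three]⟩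

theorem exists_tangent {w : EuclideanSpace ℝ (Fin 3)}
    (hw : inner ℝ (southPole : EuclideanSpace ℝ (Fin 3)) w = 0) :
    ∃ v, tangentIncl southPole v = w := by
  have := Fact.mk (@finrank_euclideanSpace_fin ℝ _ (2 + 1))
  have h : w ∈ (mvfderiv (𝓡 2) ((↑) : S2 → EuclideanSpace ℝ (Fin 3)) southPole).range :=
    (range_mvfderiv_subtypeVal (n := 2) (E := EuclideanSpace ℝ (Fin 3)) southPole).symm ▸
      Submodule.mem_orthogonal_singleton_iff_inner_right.2 hw
  exact h

/-- The tangent vector `e₁ = (1, 0, 0)` at the South Pole. -/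
def e1 : TangentSpace (𝓡 2) southPole :=
  (exists_tangent (w := !₂[1, 0, 0])
    (by simp [southPole, EuclideanSpace.inner_eq_star_dotProduct])).choose

/-- The tangent vector `e₂ = (0, 1, 0)` at the South Pole. -/
def e2 : TangentSpace (𝓡 2) southPole :=
  (exists_tangent (w := !₂[0, 1, 0])
    (by simp [southPole, EuclideanSpace.inner_eq_star_dotProduct])).choose

theorem tangentIncl_e1 : tangentIncl southPole e1 = !₂[1, 0, 0] :=
  (exists_tangent (w := !₂[1, 0, 0])
    (by simp [southPole, EuclideanSpace.inner_eq_star_dotProduct])).choose_spec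

theorem tangentIncl_e2 : tangentIncl southPole e2 = !₂[0, 1, 0] :=
  (exists_tangent (w := !₂[0, 1, 0])
    (by simp [southPole, EuclideanSpace.inner_eq_star_dotProduct])).choose_spec

/-- `Ω₁`: the elements of `Ω` that fix the South Pole and whose differential there is the
identity. -/
def Omega1 : Set Omega :=
  {f | f.1 southPole = southPole ∧ diffAt f.1 southPole = tangentIncl southPole}

/-- The map `i : SO(3) × Ω₁ → Ω`, `(A, f) ↦ A⁻¹ ∘ f`. -/
def i (p : SO3 × Omega1) : Omega := comp (rot p.1⁻¹) p.2.1

end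

end SphereDiff

namespace SphereDiff

noncomputable section

local notation "E3" => EuclideanSpace ℝ (Fin 3)

/-! Gram–Schmidt, carried out by precomposition. An upper triangular matrix with positive diagonal,
extended by 1 on the third axis, acts on the sphere after radial projection (`bend`), fixing the
South Pole; composing `f` with it on the right multiplies the differential there by that matrix
(`diffAt_comp_bendOmega`). The triangular factor that orthonormalises `df e₁, df e₂` is an explicit
smooth function `param f` of their Gram matrix. Its diagonal is stored as logarithms, so the
parameter space is a vector space and the path `t • param f` never leaves the invertible matrices.
The deformation is `f ∘ bend (t • param f)`. Rotations on the left preserve the Gram matrix, which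
gives equivariance; a rotation has identity Gram matrix, hence parameter 0, and stays put. At `t =
1` the differential is orthonormal, and `range_i` identifies this with the image of `i`. Smoothness
reduces to that of `param` along plots (`contDiffOn_param`). -/

/-! ### Differentials of maps of the sphere -/

theorem tangentIncl_injective (x : S2) : Function.Injective (tangentIncl x) :=
  have := Fact.mk (@finrank_euclideanSpace_fin ℝ _ (2 + 1))
  injective_mvfderiv_subtypeVal_sphere (n := 2) (E := E3) x

theorem inner_tangentIncl (x : S2) (v : TangentSpace (𝓡 2) x) :
    inner ℝ (x : E3) (tangentIncl x v) = 0 := by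
  have := Fact.mk (@finrank_euclideanSpace_fin ℝ _ (2 + 1))
  have h : tangentIncl x v ∈ (mvfderiv (𝓡 2) ((↑) : S2 → E3) x).range := ⟨v, rfl⟩
  rw [range_mvfderiv_subtypeVal (n := 2) (E := E3) x] at h
  exact Submodule.mem_orthogonal_singleton_iff_inner_right.1 h

/-- The differential of a map of the sphere that is the restriction of a map of `ℝ³`. -/
theorem diffAt_of_hasFDerivAt {f : S2 → S2} (hf : ContMDiff (𝓡 2) (𝓡 2) ∞ f) {G : E3 → E3}
    {G' : E3 →L[ℝ] E3} {x : S2} (hG : HasFDerivAt G G' x) (hfG : ∀ y : S2, (f y : E3) = G y)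
    (v : TangentSpace (𝓡 2) x) : diffAt f x v = G' (tangentIncl x v) := by
  rw [diffAt_eq hf]
  have h := mfderiv_comp_apply (I := 𝓡 2) (I' := 𝓘(ℝ, E3)) (I'' := 𝓘(ℝ, E3)) x (g := G)
    (f := fun y : S2 => (y : E3)) hG.differentiableAt.mdifferentiableAt
    ((contMDiff_val x).mdifferentiableAt (by simp)) v
  have e : (fun y : S2 => (f y : E3)) = G ∘ fun y : S2 => (y : E3) := funext hfG
  rw [e]
  refine h.trans ?_
  rw [mfderiv_eq_fderiv, hG.fderiv]
  rfl

/-- The differential of a map of the sphere as a derivative along a curve. -/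
theorem hasDerivAt_comp_curve {f : S2 → S2} (hf : ContMDiff (𝓡 2) (𝓡 2) ∞ f) {γ : ℝ → S2}
    (hγ : ContMDiff 𝓘(ℝ, ℝ) (𝓡 2) ∞ γ) {x : S2} (hx : γ 0 = x) {v : TangentSpace (𝓡 2) x}
    (hv : HasDerivAt (fun τ => (γ τ : E3)) (tangentIncl x v) 0) :
    HasDerivAt (fun τ => (f (γ τ) : E3)) (diffAt f x v) 0 := by
  subst hx
  have key {g : S2 → E3} (hg : ContMDiff (𝓡 2) 𝓘(ℝ, E3) ∞ g) :
      HasDerivAt (fun τ => g (γ τ))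
        (mvfderiv (𝓡 2) g (γ 0) (mfderiv 𝓘(ℝ, ℝ) (𝓡 2) γ 0 (1 : ℝ))) 0 := by
    have hd : DifferentiableAt ℝ (fun τ => g (γ τ)) 0 :=
      ((hg.comp hγ).contDiff.differentiable (by simp)) 0
    have h := mfderiv_comp_apply (I := 𝓘(ℝ, ℝ)) (I' := 𝓡 2) (I'' := 𝓘(ℝ, E3)) 0 (g := g) (f := γ)
      ((hg (γ 0)).mdifferentiableAt (by simp)) ((hγ 0).mdifferentiableAt (by simp)) (1 : ℝ)
    rw [mfderiv_eq_fderiv] at h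
    have h2 := hd.hasFDerivAt.hasDerivAt
    exact h2.congr_deriv h
  -- The abstract velocity of the curve is determined by its image in `ℝ³`, because the sphere is
  -- immersed.
  have hu : mfderiv 𝓘(ℝ, ℝ) (𝓡 2) γ 0 (1 : ℝ) = v :=
    tangentIncl_injective _ ((key contMDiff_val).unique hv)
  rw [diffAt_eq hf, ← hu]
  exact key (contMDiff_val.comp hf)

/-! ### A family of diffeomorphisms fixing the South Pole -/

/-- The linear map of `ℝ³` with matrix `[[exp a, b, 0], [0, exp c, 0], [0, 0, 1]]`. -/
def shear (p : ℝ × ℝ × ℝ) : E3 →L[ℝ] E3 :=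
  LinearMap.toContinuousLinearMap
    { toFun := fun x =>
        !₂[Real.exp p.1 * x 0 + p.2.1 * x 1, Real.exp p.2.2 * x 1, x 2]
      map_add' := fun x y => by ext j; fin_cases j <;> simp <;> ring
      map_smul' := fun r x => by ext j; fin_cases j <;> simp; all_goals ring }

theorem shear_apply (p : ℝ × ℝ × ℝ) (x : E3) :
    shear p x = !₂[Real.exp p.1 * x 0 + p.2.1 * x 1, Real.exp p.2.2 * x 1, x 2] := rfl

/-- The parameters of the inverse matrix. -/
def shearInv (p : ℝ × ℝ × ℝ) : ℝ × ℝ × ℝ :=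
  (-p.1, -(p.2.1 * Real.exp (-p.1) * Real.exp (-p.2.2)), -p.2.2)

theorem shearInv_shearInv (p : ℝ × ℝ × ℝ) : shearInv (shearInv p) = p := by
  refine Prod.ext (by simp [shearInv]) (Prod.ext ?_ (by simp [shearInv]))
  simp only [shearInv, neg_neg, neg_mul, Real.exp_neg]
  field_simp

theorem shear_shearInv (p : ℝ × ℝ × ℝ) (x : E3) : shear p (shear (shearInv p) x) = x := by
  ext j
  fin_cases j
  · simp [shear_apply, shearInv, Real.exp_neg]
    field_simp
    ring
  · simp [shear_apply, shearInv, Real.exp_neg]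
  · simp [shear_apply]

theorem shearInv_shear (p : ℝ × ℝ × ℝ) (x : E3) : shear (shearInv p) (shear p x) = x := by
  have := shear_shearInv (shearInv p) x
  rwa [shearInv_shearInv] at this

theorem shear_ne_zero (p : ℝ × ℝ × ℝ) {x : E3} (hx : x ≠ 0) : shear p x ≠ 0 := by
  intro h
  apply hx
  rw [← shearInv_shear p x, h, map_zero]

theorem shear_zero (x : E3) : shear 0 x = x := by
  ext j
  fin_cases j <;> simp [shear_apply]

theorem contDiff_shear :
    ContDiff ℝ ∞ (fun z : (ℝ × ℝ × ℝ) × E3 => shear z.1 z.2) := by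
  rw [contDiff_euclidean]
  intro j
  fin_cases j <;> simp [shear_apply] <;> fun_prop

/-- This is the shape of the differential of `normalize`: a rescaling plus multiples of the base
vector, which the determinant ignores. -/
theorem det3_smul_add (b c : ℝ) (u v w : E3) (r : ℝ) :
    det3 (r • u) (r • v + b • u) (r • w + c • u) = r ^ 3 * det3 u v w := by
  simp [det3, Matrix.det_fin_three]
  ring

theorem det3_shear (p : ℝ × ℝ × ℝ) (u v w : E3) :
    det3 (shear p u) (shear p v) (shear p w) =
      Real.exp p.1 * Real.exp p.2.2 * det3 u v w := by
  simp [det3, Matrix.det_fin_three, shear_apply]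
  ring

/-- Radial projection. -/
def normalize (x : E3) : E3 := ‖x‖⁻¹ • x

theorem normalize_mem {x : E3} (hx : x ≠ 0) :
    normalize x ∈ Metric.sphere (0 : E3) 1 := by
  rw [mem_sphere_zero_iff_norm, normalize, norm_smul, norm_inv, norm_norm,
    inv_mul_cancel₀ (norm_ne_zero_iff.2 hx)]

theorem normalize_of_mem (x : S2) : normalize x = x := by
  simp [normalize]

theorem normalize_smul {r : ℝ} (hr : 0 < r) (x : E3) : normalize (r • x) = normalize x := by
  rw [normalize, normalize, norm_smul, smul_smul, Real.norm_of_nonneg hr.le]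
  congr 1
  field_simp

theorem normalize_map_normalize (T : E3 →L[ℝ] E3) {x : E3} (hx : x ≠ 0) :
    normalize (T (normalize x)) = normalize (T x) := by
  rw [normalize.eq_def x, map_smul,
    normalize_smul (inv_pos.2 (norm_pos_iff.2 hx))]

theorem contDiffAt_normalize {x : E3} (hx : x ≠ 0) : ContDiffAt ℝ ∞ normalize x :=
  ((contDiffAt_norm ℝ hx).inv (norm_ne_zero_iff.2 hx)).smul contDiffAt_id

/-- Product rule. The functional `L` need not be computed, since its contribution is radial. -/
theorem hasFDerivAt_normalize {x : E3} (hx : x ≠ 0) :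
    ∃ L : E3 →L[ℝ] ℝ, HasFDerivAt normalize
      (‖x‖⁻¹ • ContinuousLinearMap.id ℝ E3 + L.smulRight x) x := by
  have h : DifferentiableAt ℝ (fun y : E3 => ‖y‖⁻¹) x :=
    ((contDiffAt_norm ℝ hx).differentiableAt (by simp : (∞ : WithTop ℕ∞) ≠ 0)).inv
      (norm_ne_zero_iff.2 hx)
  exact ⟨_, h.hasFDerivAt.smul (hasFDerivAt_id x)⟩

theorem coe_ne_zero (x : S2) : (x : E3) ≠ 0 := by
  rw [← norm_ne_zero_iff]
  simp

/-- The map `x ↦ M x / ‖M x‖` of the sphere, where `M = shear p`. -/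
def bend (p : ℝ × ℝ × ℝ) (x : S2) : S2 :=
  ⟨normalize (shear p x), normalize_mem (shear_ne_zero p (coe_ne_zero x))⟩

/-- Joint smoothness in the parameter is what plots of `Ω` require. -/
theorem contMDiff_bend : ContMDiff (𝓘(ℝ, ℝ × ℝ × ℝ).prod (𝓡 2)) (𝓡 2) ∞
    (fun z : (ℝ × ℝ × ℝ) × S2 => bend z.1 z.2) := by
  have := Fact.mk (@finrank_euclideanSpace_fin ℝ _ (2 + 1))
  refine ContMDiff.codRestrict_sphere (n := 2) (E := E3)
    (f := fun z : (ℝ × ℝ × ℝ) × S2 => normalize (shear z.1 z.2)) ?_ _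
  have h1 : ContMDiff (𝓘(ℝ, ℝ × ℝ × ℝ).prod (𝓡 2)) 𝓘(ℝ, (ℝ × ℝ × ℝ) × E3) ∞
      (fun z : (ℝ × ℝ × ℝ) × S2 => (z.1, (z.2 : E3))) :=
    contMDiff_fst.prodMk_space (contMDiff_val.comp contMDiff_snd)
  intro z
  exact ContMDiffAt.comp (I' := 𝓘(ℝ, E3)) (g := normalize)
    (f := fun z : (ℝ × ℝ × ℝ) × S2 => shear z.1 z.2) z
    ((contDiffAt_normalize (shear_ne_zero z.1 (coe_ne_zero z.2))).contMDiffAt)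
    ((contDiff_shear.contMDiff.comp h1) z)

theorem contMDiff_bend_right (p : ℝ × ℝ × ℝ) : ContMDiff (𝓡 2) (𝓡 2) ∞ (bend p) :=
  ContMDiff.comp (g := fun z : (ℝ × ℝ × ℝ) × S2 => bend z.1 z.2) (f := fun x : S2 => (p, x))
    contMDiff_bend (contMDiff_const.prodMk contMDiff_id)

theorem bend_zero (x : S2) : bend 0 x = x := by
  apply Subtype.ext
  simp [bend, shear_zero, normalize_of_mem]

theorem bend_bend_shearInv (p : ℝ × ℝ × ℝ) (x : S2) : bend p (bend (shearInv p) x) = x := by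
  apply Subtype.ext
  simp only [bend]
  rw [normalize_map_normalize _ (shear_ne_zero _ (coe_ne_zero x)), shear_shearInv,
    normalize_of_mem]

/-- The determinant gets multiplied by `exp a * exp c` from the matrix and by `‖M x‖⁻³` from the
projection, both positive. -/
theorem orientationPreserving_bend (p : ℝ × ℝ × ℝ) : OrientationPreserving (bend p) := by
  intro x v w h
  have hx := shear_ne_zero p (coe_ne_zero x)
  obtain ⟨L, hL⟩ := hasFDerivAt_normalize hx
  have hd := diffAt_of_hasFDerivAt (contMDiff_bend_right p)
    (hL.comp (x : E3) (shear p).hasFDerivAt) (fun y => rfl)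
  rw [hd, hd]
  have e : ((bend p x : S2) : E3) = ‖shear p x‖⁻¹ • shear p x := rfl
  simp only [e, ContinuousLinearMap.comp_apply, add_apply,
    smul_apply, ContinuousLinearMap.id_apply,
    ContinuousLinearMap.smulRight_apply]
  rw [det3_smul_add, det3_shear]
  have := norm_pos_iff.2 hx
  positivity

/-- The map `bend p` as an element of `Ω`. -/
def bendOmega (p : ℝ × ℝ × ℝ) : Omega :=
  ⟨{ toFun := bend p
     invFun := bend (shearInv p)
     left_inv := fun x => by
       have := bend_bend_shearInv (shearInv p) x
       rwa [shearInv_shearInv] at this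
     right_inv := bend_bend_shearInv p
     contMDiff_toFun := contMDiff_bend_right p
     contMDiff_invFun := contMDiff_bend_right _ },
   orientationPreserving_bend p⟩

/-! ### Curves through the South Pole -/

/-- The point `(a, b, -1)`. -/
def planePoint (h : ℝ × ℝ) : E3 := !₂[h.1, h.2, -1]

theorem planePoint_ne_zero (h : ℝ × ℝ) : planePoint h ≠ 0 := fun e => by
  simpa [planePoint] using congrArg (fun x : E3 => x 2) e

/-- The curve `τ ↦ (τ a, τ b, -1) / ‖(τ a, τ b, -1)‖`. -/
def poleCurve (h : ℝ × ℝ) (τ : ℝ) : S2 :=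
  ⟨normalize (planePoint (τ • h)), normalize_mem (planePoint_ne_zero _)⟩

theorem contMDiff_poleCurve (h : ℝ × ℝ) : ContMDiff 𝓘(ℝ, ℝ) (𝓡 2) ∞ (poleCurve h) := by
  have := Fact.mk (@finrank_euclideanSpace_fin ℝ _ (2 + 1))
  refine ContMDiff.codRestrict_sphere (n := 2) (E := E3)
    (f := fun τ : ℝ => normalize (planePoint (τ • h))) ?_ _
  rw [contMDiff_iff_contDiff, contDiff_iff_contDiffAt]
  intro τ
  refine ContDiffAt.comp (g := normalize) (f := fun τ : ℝ => planePoint (τ • h)) τ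
    (contDiffAt_normalize (planePoint_ne_zero _)) ?_
  rw [contDiffAt_euclidean]
  intro j
  fin_cases j <;> simp [planePoint] <;> fun_prop

theorem poleCurve_zero (h : ℝ × ℝ) : poleCurve h 0 = southPole := by
  apply Subtype.ext
  rw [← normalize_of_mem southPole]
  simp [poleCurve, planePoint, southPole]

/-- The norm of `(τ a, τ b, -1)` is stationary at `τ = 0`, so the radial projection does not alter
the velocity. -/
theorem hasDerivAt_poleCurve (h : ℝ × ℝ) :
    HasDerivAt (fun τ => (poleCurve h τ : E3)) (tangentIncl southPole (h.1 • e1 + h.2 • e2)) 0 := by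
  have hn (τ : ℝ) : ‖planePoint (τ • h)‖ = √(1 + τ ^ 2 * (h.1 ^ 2 + h.2 ^ 2)) := by
    rw [EuclideanSpace.norm_eq]
    congr 1
    simp [planePoint, Fin.sum_univ_three]
    ring
  have hpos : (1 : ℝ) + 0 ^ 2 * (h.1 ^ 2 + h.2 ^ 2) ≠ 0 := by simp
  have h1 : HasDerivAt (fun τ : ℝ => ‖planePoint (τ • h)‖⁻¹) 0 0 := by
    simp only [hn]
    have a1 : HasDerivAt (fun τ : ℝ => 1 + τ ^ 2 * (h.1 ^ 2 + h.2 ^ 2)) 0 0 := by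
      have := (((hasDerivAt_id (0 : ℝ)).pow 2).mul_const (h.1 ^ 2 + h.2 ^ 2)).const_add 1
      simpa using this
    have a2 := (a1.sqrt hpos).inv (by simp)
    exact a2.congr_deriv (by simp)
  have h2 : HasDerivAt (fun τ : ℝ => planePoint (τ • h)) !₂[h.1, h.2, 0] 0 := by
    have e : (fun τ : ℝ => planePoint (τ • h)) =
        fun τ : ℝ => planePoint 0 + τ • (!₂[h.1, h.2, 0] : E3) := by
      ext τ j
      fin_cases j <;> simp [planePoint]
    rw [e]
    simpa using ((hasDerivAt_id (0 : ℝ)).smul_const (!₂[h.1, h.2, 0] : E3)).const_add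
      (planePoint 0)
  refine (h1.smul h2).congr_deriv ?_
  rw [map_add, map_smul, map_smul, tangentIncl_e1, tangentIncl_e2, hn]
  ext j
  fin_cases j <;> simp

/-- The matrix preserves the plane `z = -1` and acts linearly on it, and radial projection may be
postponed to the end. This encodes the differential of `bend p` at the pole. -/
theorem bend_poleCurve (p : ℝ × ℝ × ℝ) (h : ℝ × ℝ) (τ : ℝ) :
    bend p (poleCurve h τ) =
      poleCurve (Real.exp p.1 * h.1 + p.2.1 * h.2, Real.exp p.2.2 * h.2) τ := by
  apply Subtype.ext
  simp only [bend, poleCurve]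
  rw [normalize_map_normalize _ (planePoint_ne_zero _)]
  congr 1
  ext j
  fin_cases j <;> simp [shear_apply, planePoint] <;> ring

theorem hasDerivAt_omega_poleCurve (f : Omega) (h : ℝ × ℝ) :
    HasDerivAt (fun τ => (f.1 (poleCurve h τ) : E3))
      (h.1 • diffAt f.1 southPole e1 + h.2 • diffAt f.1 southPole e2) 0 := by
  rw [← map_smul, ← map_smul, ← map_add]
  exact hasDerivAt_comp_curve f.1.contMDiff (contMDiff_poleCurve h) (poleCurve_zero h)
    (hasDerivAt_poleCurve h)

/-- Both sides are the velocity of one and the same curve. -/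
theorem diffAt_comp_bendOmega (f : Omega) (p : ℝ × ℝ × ℝ) (h : ℝ × ℝ) :
    h.1 • diffAt (comp f (bendOmega p)).1 southPole e1 +
        h.2 • diffAt (comp f (bendOmega p)).1 southPole e2 =
      (Real.exp p.1 * h.1 + p.2.1 * h.2) • diffAt f.1 southPole e1 +
        (Real.exp p.2.2 * h.2) • diffAt f.1 southPole e2 := by
  refine (hasDerivAt_omega_poleCurve (comp f (bendOmega p)) h).unique ?_
  have := hasDerivAt_omega_poleCurve f
    (Real.exp p.1 * h.1 + p.2.1 * h.2, Real.exp p.2.2 * h.2)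
  simp only [← bend_poleCurve] at this
  exact this

/-! ### Inner products and rotations -/

theorem inner_eq_sum (u v : E3) : inner ℝ u v = u 0 * v 0 + u 1 * v 1 + u 2 * v 2 := by
  simp [PiLp.inner_apply, Fin.sum_univ_three]
  ring

theorem diffAt_comp_rot (A : SO3) (f : Omega) (x : S2) (v : TangentSpace (𝓡 2) x) :
    diffAt (comp (rot A) f).1 x v = Matrix.toEuclideanCLM (𝕜 := ℝ) A.1 (diffAt f.1 x v) := by
  have h1 : diffAt (comp (rot A) f).1 x v =
      diffAt (rotFun A) (f.1 x) (mfderiv (𝓡 2) (𝓡 2) f.1 x v) :=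
    congrArg (tangentIncl (rotFun A (f.1 x))) (mfderiv_comp_apply x
      ((contMDiff_rotFun A (f.1 x)).mdifferentiableAt (by simp))
      ((f.1.contMDiff x).mdifferentiableAt (by simp)) v)
  rw [h1, diffAt_of_hasFDerivAt (contMDiff_rotFun A)
    (Matrix.toEuclideanCLM (𝕜 := ℝ) A.1).hasFDerivAt (fun y => rfl)]
  rfl

theorem diffAt_rot (A : SO3) (x : S2) (v : TangentSpace (𝓡 2) x) :
    diffAt (rot A).1 x v = Matrix.toEuclideanCLM (𝕜 := ℝ) A.1 (tangentIncl x v) :=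
  diffAt_of_hasFDerivAt (contMDiff_rotFun A)
    (Matrix.toEuclideanCLM (𝕜 := ℝ) A.1).hasFDerivAt (fun _ => rfl) v

theorem inner_rot (A : SO3) (u v : E3) :
    inner ℝ (Matrix.toEuclideanCLM (𝕜 := ℝ) A.1 u) (Matrix.toEuclideanCLM (𝕜 := ℝ) A.1 v) =
      inner ℝ u v := by
  have hA : A.1.transpose * A.1 = 1 :=
    (Matrix.mem_orthogonalGroup_iff' (Fin 3) ℝ).1
      (Matrix.mem_specialOrthogonalGroup_iff.1 A.2).1
  simp only [EuclideanSpace.inner_eq_star_dotProduct, Matrix.ofLp_toEuclideanCLM, star_trivial]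
  rw [Matrix.dotProduct_mulVec, ← Matrix.mulVec_transpose, Matrix.mulVec_mulVec, hA,
    Matrix.one_mulVec]

/-! ### The Gram matrix of the differential at the South Pole -/

/-- The outward normal at the South Pole points down, so `(e₂, e₁)` is the positive order. -/
theorem det3_diffAt_pos (f : Omega) :
    0 < det3 (f.1 southPole) (diffAt f.1 southPole e2) (diffAt f.1 southPole e1) := by
  apply f.2
  rw [tangentIncl_e1, tangentIncl_e2]
  simp [det3, Matrix.det_fin_three, southPole]

/-- The squared length of `df(e₁)`. -/
def gramE (f : Omega) : ℝ := inner ℝ (diffAt f.1 southPole e1) (diffAt f.1 southPole e1)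

/-- The inner product of `df(e₁)` and `df(e₂)`. -/
def gramF (f : Omega) : ℝ := inner ℝ (diffAt f.1 southPole e1) (diffAt f.1 southPole e2)

/-- The squared length of `df(e₂)`. -/
def gramG (f : Omega) : ℝ := inner ℝ (diffAt f.1 southPole e2) (diffAt f.1 southPole e2)

/-- The Gram determinant of `df(e₁)` and `df(e₂)`. -/
def gramD (f : Omega) : ℝ := gramE f * gramG f - gramF f ^ 2

/-- Lagrange's identity: the Gram determinant is the squared norm of the cross product, whose
vanishing would kill the determinant. -/
theorem inner_mul_inner_sub_sq_pos {u v w : E3} (h : det3 u w v ≠ 0) :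
    0 < inner ℝ v v * inner ℝ w w - inner ℝ v w ^ 2 := by
  have key : inner ℝ v v * inner ℝ w w - inner ℝ v w ^ 2 =
      (v 0 * w 1 - v 1 * w 0) ^ 2 + (v 0 * w 2 - v 2 * w 0) ^ 2 +
        (v 1 * w 2 - v 2 * w 1) ^ 2 := by
    simp only [inner_eq_sum]
    ring
  rw [key]
  by_contra! hle
  have s0 := sq_nonneg (v 0 * w 1 - v 1 * w 0)
  have s1 := sq_nonneg (v 0 * w 2 - v 2 * w 0)
  have s2 := sq_nonneg (v 1 * w 2 - v 2 * w 1)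
  have h0 : v 0 * w 1 - v 1 * w 0 = 0 := (pow_eq_zero_iff two_ne_zero).1 (by linarith)
  have h1 : v 0 * w 2 - v 2 * w 0 = 0 := (pow_eq_zero_iff two_ne_zero).1 (by linarith)
  have h2 : v 1 * w 2 - v 2 * w 1 = 0 := (pow_eq_zero_iff two_ne_zero).1 (by linarith)
  apply h
  simp only [det3, Matrix.det_fin_three, Matrix.of_apply, Matrix.cons_val]
  linear_combination -(u 2) * h0 + u 1 * h1 - u 0 * h2

theorem gramD_pos (f : Omega) : 0 < gramD f :=
  inner_mul_inner_sub_sq_pos (det3_diffAt_pos f).ne'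

theorem gramE_pos (f : Omega) : 0 < gramE f := by
  have h := gramD_pos f
  rw [gramD] at h
  refine lt_of_le_of_ne real_inner_self_nonneg fun e => ?_
  rw [← e] at h
  nlinarith [sq_nonneg (gramF f)]

/-- The parameters of the inverse of the triangular factor in the Gram–Schmidt decomposition of
the differential at the South Pole. -/
def param (f : Omega) : ℝ × ℝ × ℝ :=
  (-(Real.log (gramE f) / 2), -(gramF f / (√(gramE f) * √(gramD f))),
    -(Real.log (gramD f / gramE f) / 2))

theorem param_comp_rot (A : SO3) (f : Omega) : param (comp (rot A) f) = param f := by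
  simp only [param, gramD, gramE, gramF, gramG, diffAt_comp_rot, inner_rot]

theorem param_rot (A : SO3) : param (rot A) = 0 := by
  have hE : gramE (rot A) = 1 := by
    rw [gramE, diffAt_rot, inner_rot, tangentIncl_e1, inner_eq_sum]
    simp
  have hF : gramF (rot A) = 0 := by
    rw [gramF, diffAt_rot, diffAt_rot, inner_rot, tangentIncl_e1, tangentIncl_e2, inner_eq_sum]
    simp
  have hG : gramG (rot A) = 1 := by
    rw [gramG, diffAt_rot, inner_rot, tangentIncl_e2, inner_eq_sum]
    simp
  simp [param, gramD, hE, hF, hG]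

theorem exp_neg_log_div_two {x : ℝ} (hx : 0 < x) : Real.exp (-(Real.log x / 2)) = (√x)⁻¹ := by
  rw [Real.exp_neg, ← Real.log_sqrt hx.le, Real.exp_log (Real.sqrt_pos.2 hx)]

theorem orthonormal_pair_iff {u v : E3} :
    Orthonormal ℝ ![u, v] ↔ inner ℝ u u = 1 ∧ inner ℝ u v = 0 ∧ inner ℝ v v = 1 := by
  rw [orthonormal_iff_ite]
  constructor
  · intro h
    exact ⟨by simpa using h 0 0, by simpa using h 0 1, by simpa using h 1 1⟩
  · rintro ⟨h1, h2, h3⟩ i j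
    have h2' : inner ℝ v u = 0 := by rw [real_inner_comm, h2]
    fin_cases i <;> fin_cases j <;> simp_all

theorem orthonormal_diffAt_comp_bendOmega (f : Omega) :
    Orthonormal ℝ ![diffAt (comp f (bendOmega (param f))).1 southPole e1,
      diffAt (comp f (bendOmega (param f))).1 southPole e2] := by
  have hE := gramE_pos f
  have hD := gramD_pos f
  have h1 := diffAt_comp_bendOmega f (param f) (1, 0)
  have h2 := diffAt_comp_bendOmega f (param f) (0, 1)
  simp only [one_smul, zero_smul, add_zero, zero_add, mul_one, mul_zero] at h1 h2
  have ep : Real.exp (param f).1 = (√(gramE f))⁻¹ := exp_neg_log_div_two hE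
  have er : Real.exp (param f).2.2 = √(gramE f) / √(gramD f) := by
    rw [param, exp_neg_log_div_two (div_pos hD hE), Real.sqrt_div hD.le, inv_div]
  have eq : (param f).2.1 = -(gramF f / (√(gramE f) * √(gramD f))) := rfl
  have sE : √(gramE f) ^ 2 = gramE f := Real.sq_sqrt hE.le
  have sD : √(gramD f) ^ 2 = gramE f * gramG f - gramF f ^ 2 := Real.sq_sqrt hD.le
  have pE := (Real.sqrt_pos.2 hE).ne'
  have pD := (Real.sqrt_pos.2 hD).ne'
  have iE : inner ℝ (diffAt f.1 southPole e1) (diffAt f.1 southPole e1) = gramE f := rfl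
  have iF : inner ℝ (diffAt f.1 southPole e1) (diffAt f.1 southPole e2) = gramF f := rfl
  have iF' : inner ℝ (diffAt f.1 southPole e2) (diffAt f.1 southPole e1) = gramF f :=
    real_inner_comm _ _
  have iG : inner ℝ (diffAt f.1 southPole e2) (diffAt f.1 southPole e2) = gramG f := rfl
  rw [orthonormal_pair_iff, h1, h2, ep, er, eq]
  simp only [inner_add_left, inner_add_right, real_inner_smul_left, real_inner_smul_right,
    iE, iF, iF', iG]
  -- With the roots as atoms and `gramE f` rewritten as `a ^ 2`, only rational identities modulo `d
  -- ^ 2 = a ^ 2 * G - F ^ 2` remain.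
  generalize √(gramE f) = a at *
  generalize √(gramD f) = d at *
  rw [← sE] at sD ⊢
  refine ⟨?_, ?_, ?_⟩
  · field_simp
  · field_simp
    ring
  · field_simp
    linear_combination -sD

/-! ### The image of `i` -/

theorem comp_rot_rot_inv (A : SO3) (f : Omega) : comp (rot A) (comp (rot A⁻¹) f) = f := by
  refine Subtype.ext (Diffeomorph.ext fun x => ?_)
  change rotFun A (rotFun A⁻¹ (f.1 x)) = f.1 x
  rw [rotFun_rotFun, mul_inv_cancel, rotFun_one]

theorem tangent_eq_smul_add (v : TangentSpace (𝓡 2) southPole) :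
    v = (tangentIncl southPole v 0) • e1 + (tangentIncl southPole v 1) • e2 := by
  apply tangentIncl_injective
  have h := inner_tangentIncl southPole v
  rw [inner_eq_sum] at h
  rw [map_add, map_smul, map_smul, tangentIncl_e1, tangentIncl_e2]
  ext j
  fin_cases j
  · simp
  · simp
  · simpa [southPole] using h

theorem inner_diffAt (f : Omega) (x : S2) (v : TangentSpace (𝓡 2) x) :
    inner ℝ (f.1 x : E3) (diffAt f.1 x v) = 0 :=
  inner_tangentIncl _ _

/-- The rotation sending the South Pole, `e₁` and `e₂` to a given orthonormal frame. -/
theorem exists_rot {x u v : E3} (hxx : inner ℝ x x = 1) (hxu : inner ℝ x u = 0)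
    (hxv : inner ℝ x v = 0) (huu : inner ℝ u u = 1) (huv : inner ℝ u v = 0)
    (hvv : inner ℝ v v = 1) (hdet : 0 < det3 x v u) :
    ∃ A : SO3, Matrix.toEuclideanCLM (𝕜 := ℝ) A.1 southPole = x ∧
      Matrix.toEuclideanCLM (𝕜 := ℝ) A.1 !₂[1, 0, 0] = u ∧
      Matrix.toEuclideanCLM (𝕜 := ℝ) A.1 !₂[0, 1, 0] = v := by
  -- The third column is `-x` because the South Pole is minus the third basis vector.
  let B : Matrix (Fin 3) (Fin 3) ℝ := (Matrix.of ![u.ofLp, v.ofLp, -x.ofLp]).transpose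
  simp only [inner_eq_sum] at hxx hxu hxv huu huv hvv
  have hB : B.transpose * B = 1 := by
    ext i j
    fin_cases i <;> fin_cases j <;> simp [B, Matrix.mul_apply, Fin.sum_univ_three] <;> linarith
  have hdB : B.det = det3 x v u := by
    simp [B, det3, Matrix.det_fin_three]
    ring
  -- Orthogonality gives `det ^ 2 = 1`; the orientation hypothesis selects the sign.
  have hd : B.det = 1 := by
    have h := congrArg Matrix.det hB
    rw [Matrix.det_mul, Matrix.det_transpose, Matrix.det_one] at h
    nlinarith
  refine ⟨⟨B, Matrix.mem_specialOrthogonalGroup_iff.2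
    ⟨(Matrix.mem_orthogonalGroup_iff' (Fin 3) ℝ).2 hB, hd⟩⟩, ?_, ?_, ?_⟩
  all_goals
    ext j
    fin_cases j <;>
      simp [B, Matrix.mulVec, dotProduct, Fin.sum_univ_three, southPole]

/-- Rotations are isometries, which gives one inclusion. Conversely, undoing the rotation onto the
frame `(df e₁, df e₂)` at `f x₀` leaves an element of `Ω₁`. -/
theorem range_i :
    Set.range i = {f : Omega | Orthonormal ℝ
      ![diffAt f.1 southPole e1, diffAt f.1 southPole e2]} := by
  ext f
  constructor
  · rintro ⟨⟨A, g, hg0, hg⟩, rfl⟩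
    rw [Set.mem_ofPred_eq, orthonormal_pair_iff]
    simp only [i, diffAt_comp_rot, inner_rot, hg, tangentIncl_e1, tangentIncl_e2]
    simp only [inner_eq_sum]
    simp
  · intro hf
    rw [Set.mem_ofPred_eq, orthonormal_pair_iff] at hf
    obtain ⟨A, hx, hu, hv⟩ := exists_rot (x := f.1 southPole)
      (u := diffAt f.1 southPole e1) (v := diffAt f.1 southPole e2)
      (by rw [real_inner_self_eq_norm_sq]; simp) (inner_diffAt f _ _) (inner_diffAt f _ _)
      hf.1 hf.2.1 hf.2.2 (det3_diffAt_pos f)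
    have inv_apply {a b : E3} (h : Matrix.toEuclideanCLM (𝕜 := ℝ) A.1 a = b) :
        Matrix.toEuclideanCLM (𝕜 := ℝ) (A⁻¹).1 b = a := by
      rw [← h, ← mul_apply_eq_comp, ← map_mul]
      have : (A⁻¹).1 * A.1 = 1 := congrArg Subtype.val (inv_mul_cancel A)
      rw [this, map_one]
      rfl
    -- `i` inverts its first argument, hence `A⁻¹` rather than `A`.
    refine ⟨(A⁻¹, ⟨comp (rot A⁻¹) f, Subtype.ext (inv_apply hx), ?_⟩), ?_⟩
    · ext1 v
      rw [tangent_eq_smul_add v]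
      simp only [map_add, map_smul]
      rw [diffAt_comp_rot, diffAt_comp_rot, inv_apply hu, inv_apply hv, tangentIncl_e1,
        tangentIncl_e2]
    · simp only [i, inv_inv]
      exact comp_rot_rot_inv A f

/-! ### Smoothness -/

/-- Along `poleCurve` a plot becomes a smooth function of `(s, τ)` between vector spaces, and the
differential is its `τ`-derivative at 0; no tangent bundle is needed. -/
theorem contDiffOn_diffAt {n : ℕ} {U : Set (EuclideanSpace ℝ (Fin n))} (hU : IsOpen U)
    {P : EuclideanSpace ℝ (Fin n) → Omega} (hP : omegaPlots n U P) (h : ℝ × ℝ) :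
    ContDiffOn ℝ ∞ (fun s => h.1 • diffAt (P s).1 southPole e1 +
      h.2 • diffAt (P s).1 southPole e2) U := by
  let H : EuclideanSpace ℝ (Fin n) × ℝ → E3 := fun z => (P z.1).1 (poleCurve h z.2)
  have hH : ContDiffOn ℝ ∞ H (U ×ˢ Set.univ) := by
    rw [← contMDiffOn_iff_contDiffOn]
    have h1 : ContMDiff 𝓘(ℝ, EuclideanSpace ℝ (Fin n) × ℝ) ((𝓡 n).prod (𝓡 2)) ∞
        (fun z : EuclideanSpace ℝ (Fin n) × ℝ => (z.1, poleCurve h z.2)) :=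
      contDiff_fst.contMDiff.prodMk ((contMDiff_poleCurve h).comp contDiff_snd.contMDiff)
    have h2 := ContMDiffOn.comp (t := U ×ˢ Set.univ) hP (h1.contMDiffOn (s := U ×ˢ Set.univ))
      (fun z hz => ⟨hz.1, trivial⟩)
    exact contMDiff_val.comp_contMDiffOn h2
  have hopen : IsOpen (U ×ˢ (Set.univ : Set ℝ)) := hU.prod isOpen_univ
  have h3 : ContDiffOn ℝ ∞ (fun s => fderiv ℝ H (s, (0 : ℝ)) (0, 1)) U :=
    ((hH.fderiv_of_isOpen hopen (by simp)).comp (f := fun s => (s, (0 : ℝ)))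
      (contDiff_id.prodMk contDiff_const).contDiffOn
      (fun s hs => ⟨hs, trivial⟩)).clm_apply contDiffOn_const
  refine h3.congr fun s hs => ?_
  have hd : DifferentiableAt ℝ H (s, (0 : ℝ)) :=
    (hH.contDiffAt (hopen.mem_nhds ⟨hs, trivial⟩)).differentiableAt (by simp)
  exact (hasDerivAt_omega_poleCurve (P s) h).unique
    (hd.hasFDerivAt.comp_hasDerivAt (f := fun τ : ℝ => (s, τ)) 0
      ((hasDerivAt_const 0 s).prodMk (hasDerivAt_id 0)))

/-- Positivity of `gramE` and `gramD` keeps the logarithms, roots and quotients smooth. -/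
theorem contDiffOn_param {n : ℕ} {U : Set (EuclideanSpace ℝ (Fin n))} (hU : IsOpen U)
    {P : EuclideanSpace ℝ (Fin n) → Omega} (hP : omegaPlots n U P) :
    ContDiffOn ℝ ∞ (fun s => param (P s)) U := by
  have h1 : ContDiffOn ℝ ∞ (fun s => diffAt (P s).1 southPole e1) U := by
    simpa using contDiffOn_diffAt hU hP (1, 0)
  have h2 : ContDiffOn ℝ ∞ (fun s => diffAt (P s).1 southPole e2) U := by
    simpa using contDiffOn_diffAt hU hP (0, 1)
  have hE : ContDiffOn ℝ ∞ (fun s => gramE (P s)) U := h1.inner ℝ h1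
  have hF : ContDiffOn ℝ ∞ (fun s => gramF (P s)) U := h1.inner ℝ h2
  have hG : ContDiffOn ℝ ∞ (fun s => gramG (P s)) U := h2.inner ℝ h2
  have hD : ContDiffOn ℝ ∞ (fun s => gramD (P s)) U := (hE.mul hG).sub (hF.pow 2)
  have pE (s) : gramE (P s) ≠ 0 := (gramE_pos _).ne'
  have pD (s) : gramD (P s) ≠ 0 := (gramD_pos _).ne'
  refine ContDiffOn.prodMk ((hE.log fun s _ => pE s).div_const 2).neg
    (ContDiffOn.prodMk (hF.div ((hE.sqrt fun s _ => pE s).mul (hD.sqrt fun s _ => pD s)) ?_).neg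
      (((hD.div hE fun s _ => pE s).log ?_).div_const 2).neg)
  · intro s _
    exact (mul_pos (Real.sqrt_pos.2 (gramE_pos _)) (Real.sqrt_pos.2 (gramD_pos _))).ne'
  · intro s _
    exact div_ne_zero (pD s) (pE s)

theorem omegaPlots_comp_bendOmega {n : ℕ} {U : Set (EuclideanSpace ℝ (Fin n))}
    {P : EuclideanSpace ℝ (Fin n) → Omega} (hP : omegaPlots n U P)
    {p : EuclideanSpace ℝ (Fin n) → ℝ × ℝ × ℝ} (hp : ContDiffOn ℝ ∞ p U) :
    omegaPlots n U (fun s => comp (P s) (bendOmega (p s))) := by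
  have h1 : ContMDiffOn ((𝓡 n).prod (𝓡 2)) (𝓘(ℝ, ℝ × ℝ × ℝ).prod (𝓡 2)) ∞
      (fun q : EuclideanSpace ℝ (Fin n) × S2 => (p q.1, q.2)) (U ×ˢ Set.univ) :=
    (hp.contMDiffOn.comp contMDiff_fst.contMDiffOn fun q hq => hq.1).prodMk
      contMDiff_snd.contMDiffOn
  have h2 : ContMDiffOn ((𝓡 n).prod (𝓡 2)) ((𝓡 n).prod (𝓡 2)) ∞
      (fun q : EuclideanSpace ℝ (Fin n) × S2 => (q.1, bend (p q.1) q.2)) (U ×ˢ Set.univ) :=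
    contMDiff_fst.contMDiffOn.prodMk
      (ContMDiff.comp_contMDiffOn (g := fun z : (ℝ × ℝ × ℝ) × S2 => bend z.1 z.2)
        (f := fun q : EuclideanSpace ℝ (Fin n) × S2 => (p q.1, q.2)) contMDiff_bend h1)
  exact ContMDiffOn.comp (t := U ×ˢ Set.univ)
    (g := fun q : EuclideanSpace ℝ (Fin n) × S2 => (P q.1).1 q.2)
    (f := fun q : EuclideanSpace ℝ (Fin n) × S2 => (q.1, bend (p q.1) q.2)) hP h2
    fun q hq => ⟨hq.1, trivial⟩

/-- The deformation of `Ω` onto the image of `i`. -/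
def retraction (z : unitInterval × Omega) : Omega :=
  comp z.2 (bendOmega ((z.1 : ℝ) • param z.2))

theorem diffeologicallySmooth_retraction :
    DiffeologicallySmooth (prodPlots (manifoldPlots (𝓡∂ 1) unitInterval) omegaPlots)
      omegaPlots retraction := by
  intro n U hU P hP
  have ht : ContDiffOn ℝ ∞ (fun s => ((P s).1 : ℝ)) U := by
    rw [← contMDiffOn_iff_contDiffOn]
    exact contMDiff_subtypeVal_Icc.comp_contMDiffOn hP.1
  exact omegaPlots_comp_bendOmega hP.2 (ht.smul (contDiffOn_param hU hP.2))

theorem comp_bendOmega_zero (f : Omega) : comp f (bendOmega 0) = f := by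
  refine Subtype.ext (Diffeomorph.ext fun x => ?_)
  exact congrArg f.1 (bend_zero x)

end

end SphereDiff

theorem mainTheorem5 :
    Set.range SphereDiff.i =
        {f : SphereDiff.Omega | Orthonormal ℝ
          ![SphereDiff.diffAt f.1 SphereDiff.southPole SphereDiff.e1,
            SphereDiff.diffAt f.1 SphereDiff.southPole SphereDiff.e2]} ∧
    ∃ Q : unitInterval × SphereDiff.Omega → SphereDiff.Omega,
      SphereDiff.DiffeologicallySmooth
        (SphereDiff.prodPlots (SphereDiff.manifoldPlots (𝓡∂ 1) unitInterval) SphereDiff.omegaPlots)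
        SphereDiff.omegaPlots Q ∧
      (∀ f : SphereDiff.Omega, Q (0, f) = f) ∧
      (∀ f : SphereDiff.Omega, Q (1, f) ∈ Set.range SphereDiff.i) ∧
      (∀ (t : unitInterval) (A : SphereDiff.SO3), Q (t, SphereDiff.rot A) = SphereDiff.rot A) ∧
      (∀ (t : unitInterval) (f : SphereDiff.Omega) (A : SphereDiff.SO3),
        Q (t, SphereDiff.comp (SphereDiff.rot A) f) =
          SphereDiff.comp (SphereDiff.rot A) (Q (t, f))) := by
  refine ⟨SphereDiff.range_i, SphereDiff.retraction,
    SphereDiff.diffeologicallySmooth_retraction, fun f => ?_, fun f => ?_, fun t A => ?_,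
    fun t f A => ?_⟩
  · simp only [SphereDiff.retraction, Set.Icc.coe_zero, zero_smul,
      SphereDiff.comp_bendOmega_zero]
  · rw [SphereDiff.range_i]
    simp only [SphereDiff.retraction, Set.Icc.coe_one, one_smul]
    exact SphereDiff.orthonormal_diffAt_comp_bendOmega f
  · simp only [SphereDiff.retraction, SphereDiff.param_rot, smul_zero,
      SphereDiff.comp_bendOmega_zero]
  · simp only [SphereDiff.retraction, SphereDiff.param_comp_rot]
    rfl
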